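/- Throughout, $\mathcal H_d=\mathbb C^d$ with $d\ge 1$, and $\mathcal B(\mathcal H_d)$ is the set of linear operators on it. A state is a positive operator of trace one; for a unit vector $|\psi\rangle$ write $\psi=|\psi\rangle\langle\psi|$. The support $\mathrm{supp}(\rho)$ of a state $\rho$ is the span of its eigenvectors with positive eigenvalue. A quantum operation on $\mathcal H_d$ is a map $\rho\mapsto\sum_{i=1}^m E_i\rho E_i^\dagger$ with $\sum_i E_i^\dagger E_i=I$; $\mathcal I$ is the identity operation. The maximal fidelity of two states is $$\tilde F(\rho_0,\rho_1)=\max\{|\langle\psi_0|\psi_1\rangle| : |\psi_k\rangle\in\mathrm{supp}(\rho_k),\ \|\psi_k\|=1,\ k=0,1\},$$ and for two quantum operations $$\tilde F_q(\mathcal E_0,\mathcal E_1)=\min\{\tilde F(\mathcal E_0(\psi_0),\mathcal E_1(\psi_1)) : \|\psi_0\|=\|\psi_1\|=1,\ \langle\psi_0|\psi_1\rangle=q\}.$$ $\mathcal E_0$ and $\mathcal E_1$ are sequentially perfectly distinguishable with $N$ queries if there are a state $\rho$ on $\mathcal H_d$ and quantum operations $\mathcal T_0,\mathcal T_1,\dots$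 on $\mathcal H_d$ (no auxiliary system is allowed) such that the two states $\mathcal X\mathcal T_{N-1}\mathcal X\mathcal T_{N-2}\cdots\mathcal X\mathcal T_0(\rho)$, for $\mathcal X=\mathcal E_0$ and $\mathcal X=\mathcal E_1$, are told apart with certainty by a projective measurement. They are sequentially perfectly distinguishable if this holds for some $N$, and $N_{\min}$ is then the least such $N$. **Theorem.** Let $\mathcal E=\sum_{i=1}^m E_i\cdot E_i^\dagger$ be a quantum operation on $\mathcal H_d$. The minimum defining $\tilde F_1(\mathcal E,\mathcal I)$ is attained, and $\mathcal E$ and $\mathcal I$ are sequentially perfectly distinguishable if and only if $\tilde F_1(\mathcal E,\mathcal I)<1$. In that case write $\tilde F_1(\mathcal E,\mathcal I)=\cos\theta$ with $0<\theta\le\pi/2$. Then the maximum $$\cos\alpha_0=\max\{|\langle b|b'\rangle| : \|b\|=\|b'\|=1,\ \tilde F(\mathcal E(b),b)=\cos\theta,\ \langle b'|E_i|b\rangle=0 \text{ for } i=1,\dots,m\},\qquad 0\le\alpha_0\le\pi/2,$$ exists, and, with the convention $\ln 0=1$, $$\left\lceil\frac{\pi}{2\arccos\tilde F_1(\mathcal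 E,\mathcal I)}\right\rceil\le N_{\min}\le\left\lceil\frac{\ln\cos\alpha_0}{\ln\cos\theta}\right\rceil+1 .$$ -/

import Mathlib

open scoped Matrix ComplexOrder

noncomputable section

namespace SeqDisc

/-- The `d`-dimensional Hilbert space. -/
abbrev Hilb (d : ℕ) : Type := EuclideanSpace ℂ (Fin d)

/-- Linear operators on the `d`-dimensional Hilbert space. -/
abbrev Op (d : ℕ) : Type := Matrix (Fin d) (Fin d) ℂ

/-- The rank-one operator `|ψ⟩⟨φ|`. -/
def ketbra {d : ℕ} (ψ φ : Hilb d) : Op d :=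
  Matrix.vecMulVec ψ.ofLp (star φ.ofLp)

/-- A quantum state: a positive operator of trace one. -/
def IsState {d : ℕ} (ρ : Op d) : Prop :=
  ρ.PosSemidef ∧ ρ.trace = 1

/-- The support of a quantum state: the span of its eigenvectors with positive eigenvalue. -/
def supp {d : ℕ} (ρ : Op d) : Submodule ℂ (Hilb d) :=
  Submodule.span ℂ {v | ∃ p : ℝ, 0 < p ∧ Matrix.toEuclideanLin ρ v = (p : ℂ) • v}

/-- The map `ρ ↦ ∑ i, K i * ρ * (K i)†`. -/
def krausMap {d m : ℕ} (K : Fin m → Op d) : Op d →ₗ[ℂ] Op d :=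
  ∑ i, (LinearMap.mulLeft ℂ (K i)).comp (LinearMap.mulRight ℂ (K i)ᴴ)

/-- The Kraus operators of a trace-preserving map: `∑ i, (K i)† * K i = 1`. -/
def IsKraus {d m : ℕ} (K : Fin m → Op d) : Prop :=
  ∑ i, (K i)ᴴ * K i = 1

/-- A quantum operation: a trace-preserving completely positive map, in Kraus form. -/
def IsQuantumOperation {d : ℕ} (T : Op d →ₗ[ℂ] Op d) : Prop :=
  ∃ (m : ℕ) (K : Fin m → Op d), IsKraus K ∧ T = krausMap K

/-- The maximal fidelity of two states, the largest overlap of unit vectors of the two supports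
(a supremum over a compact set, which is nonempty when both arguments are states). -/
def maxFidelity {d : ℕ} (ρ₀ ρ₁ : Op d) : ℝ :=
  sSup {r | ∃ ψ₀ ∈ supp ρ₀, ∃ ψ₁ ∈ supp ρ₁, ‖ψ₀‖ = 1 ∧ ‖ψ₁‖ = 1 ∧ r = ‖inner ℂ ψ₀ ψ₁‖}

/-- The maximal fidelities of the outputs of two quantum operations, over all pairs of pure
input states with inner product `q`. -/
def fidelitySet {d : ℕ} (q : ℝ) (X₀ X₁ : Op d →ₗ[ℂ] Op d) : Set ℝ :=
  {r | ∃ ψ₀ ψ₁ : Hilb d, ‖ψ₀‖ = 1 ∧ ‖ψ₁‖ = 1 ∧ inner ℂ ψ₀ ψ₁ = (q : ℂ) ∧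
    r = maxFidelity (X₀ (ketbra ψ₀ ψ₀)) (X₁ (ketbra ψ₁ ψ₁))}

/-- The `q`-maximal fidelity of two quantum operations. -/
def qMaxFidelity {d : ℕ} (q : ℝ) (X₀ X₁ : Op d →ₗ[ℂ] Op d) : ℝ :=
  sInf (fidelitySet q X₀ X₁)

/-- The state of the system after `n` queries to `X`, when the initial state is `ρ` and the known
operation `T k` is applied immediately before query number `k + 1`
(so `T 0` is part of the preparation of the input). -/
def seqState {d : ℕ} (X : Op d →ₗ[ℂ] Op d) (ρ : Op d) (T : ℕ → Op d →ₗ[ℂ] Op d) : ℕ → Op d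
  | 0 => ρ
  | n + 1 => X (T n (seqState X ρ T n))

/-- Some projective measurement `{P, 1 - P}` tells the two states apart with certainty. -/
def PerfectlyDistinguishable {d : ℕ} (ρ σ : Op d) : Prop :=
  ∃ P : Op d, P.IsHermitian ∧ P * P = P ∧ (P * ρ).trace = 1 ∧ (P * σ).trace = 0

/-- Some sequential scheme, without auxiliary systems, perfectly distinguishes `X₀` from `X₁`
with exactly `N` queries. -/
def SeqDistinguishableIn {d : ℕ} (X₀ X₁ : Op d →ₗ[ℂ] Op d) (N : ℕ) : Prop :=
  ∃ (ρ : Op d) (T : ℕ → Op d →ₗ[ℂ] Op d), IsState ρ ∧ (∀ k, IsQuantumOperation (T k)) ∧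
    PerfectlyDistinguishable (seqState X₀ ρ T N) (seqState X₁ ρ T N)

/-- `X₀` and `X₁` are sequentially perfectly distinguishable (with finitely many queries). -/
def SeqDistinguishable {d : ℕ} (X₀ X₁ : Op d →ₗ[ℂ] Op d) : Prop :=
  ∃ N, SeqDistinguishableIn X₀ X₁ N

/-- The overlaps `|⟨b|b'⟩|` of pure states `b`, `b'` for which the maximal fidelity of `E(b)` and
`b` is `c`, and `|b⟩⟨b'|` is orthogonal, for the pairing `(A, B) ↦ tr (A B)`, to the span of the
Kraus operators: `⟨b'|K i|b⟩ = 0` for all `i`, which says that `b'` is orthogonal to `supp E(b)`. -/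
def overlapSet {d m : ℕ} (K : Fin m → Op d) (c : ℝ) : Set ℝ :=
  {r | ∃ b b' : Hilb d, ‖b‖ = 1 ∧ ‖b'‖ = 1 ∧
    maxFidelity (krausMap K (ketbra b b)) (ketbra b b) = c ∧
    (∀ A ∈ Submodule.span ℂ (Set.range K), (ketbra b b' * A).trace = 0) ∧
    r = ‖inner ℂ b b'‖}

/-- The natural logarithm with the convention `ln 0 = 1`. -/
def ln (x : ℝ) : ℝ := if x = 0 then 1 else Real.log x

end SeqDisc

end

namespace SeqDisc

open Matrix (toEuclideanLin)

variable {d m : ℕ}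

/-! ### Matrices as operators on the Hilbert space -/

/-! The support of `E(ψ)` is the span `S` of the vectors `E_i ψ`, so the maximal fidelity of `E(ψ)`
and `ψ` is the norm of the projection of `ψ` to `S`. This norm is lower semicontinuous in `ψ`, so it
attains a minimum `cos θ` on the unit sphere.

Lower bound: follow one unit vector in each of the two supports. A known operation can be followed
without loss of overlap (`exists_unit_krausSpan_norm_inner_ge`), and a query need turn one of the
vectors by at most `θ`. After `n` queries with `nθ < π/2` the overlap is at least `cos(nθ) > 0`,
whereas perfectly distinguishable states have orthogonal supports. Hence `Nθ ≥ π/2`, which is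
impossible for `θ = 0`.

Upper bound: write a minimizer as `b = cos θ s + sin θ t` with `s` in `S` and `t` orthogonal to `S`.
After a query to `E` with input `b`, the output lies in `S`; with the identity, the other vector
stays where it is, say at angle `θ + β` to `s`. One operation resets every state on `S` to `b` and
sends the other vector to one at angle `θ + β` to `b`
(`exists_quantumOperation_of_norm_starProjection_le`), so each query gains an angle `θ`. Once the
second vector is `t`, a last query separates the states. Thus `(n + 1)θ ≥ π/2` suffices for `n + 1`
queries, and for `θ > 0` the lower bound is sharp.

The logarithmic bound is weaker: the maximal overlap is `sin θ`, that is `α₀ = π/2 - θ`, and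
`cos(kθ) ≤ cos^k θ` turns `cos^k θ ≤ sin θ` into `(k + 1)θ ≥ π/2`. -/

lemma toEuclideanLin_mul_apply (A B : Op d) (v : Hilb d) :
    toEuclideanLin (A * B) v = toEuclideanLin A (toEuclideanLin B v) := by
  simp

lemma toEuclideanLin_one_apply (v : Hilb d) : toEuclideanLin (1 : Op d) v = v := by
  simp

lemma toEuclideanLin_sum_apply {ι : Type*} (s : Finset ι) (A : ι → Op d) (v : Hilb d) :
    toEuclideanLin (∑ i ∈ s, A i) v = ∑ i ∈ s, toEuclideanLin (A i) v := by
  rw [map_sum, LinearMap.sum_apply]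

lemma op_ext {A B : Op d} (h : ∀ v, toEuclideanLin A v = toEuclideanLin B v) : A = B :=
  (toEuclideanLin (𝕜 := ℂ)).injective (LinearMap.ext h)

lemma inner_toEuclideanLin_left (A : Op d) (v w : Hilb d) :
    inner ℂ (toEuclideanLin A v) w = inner ℂ v (toEuclideanLin Aᴴ w) := by
  rw [Matrix.toEuclideanLin_conjTranspose_eq_adjoint, LinearMap.adjoint_inner_right]

lemma inner_toEuclideanLin_right (A : Op d) (v w : Hilb d) :
    inner ℂ v (toEuclideanLin A w) = inner ℂ (toEuclideanLin Aᴴ v) w := by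
  rw [inner_toEuclideanLin_left, Matrix.conjTranspose_conjTranspose]

lemma toEuclideanLin_ketbra (ψ φ v : Hilb d) :
    toEuclideanLin (ketbra ψ φ) v = inner ℂ φ v • ψ := by
  ext i
  simp [ketbra, Matrix.toLpLin_apply, Matrix.vecMulVec_mulVec, EuclideanSpace.inner_eq_star_dotProduct,
    dotProduct_comm, mul_comm]

lemma mul_ketbra (A : Op d) (ψ φ : Hilb d) :
    A * ketbra ψ φ = ketbra (toEuclideanLin A ψ) φ :=
  op_ext fun v => by simp [toEuclideanLin_mul_apply, toEuclideanLin_ketbra, -Matrix.toLpLin_mul_same]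

lemma conjTranspose_ketbra (ψ φ : Hilb d) : (ketbra ψ φ)ᴴ = ketbra φ ψ := by
  ext i j
  simp [ketbra, Matrix.vecMulVec_apply, mul_comm]

lemma ketbra_mul (A : Op d) (ψ φ : Hilb d) :
    ketbra ψ φ * A = ketbra ψ (toEuclideanLin Aᴴ φ) := by
  rw [← Matrix.conjTranspose_conjTranspose (ketbra ψ φ * A), Matrix.conjTranspose_mul,
    conjTranspose_ketbra, mul_ketbra, conjTranspose_ketbra]

lemma trace_ketbra (ψ φ : Hilb d) : (ketbra ψ φ).trace = inner ℂ φ ψ := by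
  simp [ketbra, Matrix.trace_vecMulVec, EuclideanSpace.inner_eq_star_dotProduct]

lemma trace_ketbra_mul (ψ φ : Hilb d) (A : Op d) :
    (ketbra ψ φ * A).trace = inner ℂ φ (toEuclideanLin A ψ) := by
  rw [ketbra_mul, trace_ketbra, inner_toEuclideanLin_right]

lemma posSemidef_ketbra (ψ : Hilb d) : (ketbra ψ ψ).PosSemidef :=
  Matrix.posSemidef_vecMulVec_self_star _

lemma inner_self_of_norm_one {ψ : Hilb d} (h : ‖ψ‖ = 1) : inner ℂ ψ ψ = (1 : ℂ) := by
  simp [inner_self_eq_norm_sq_to_K, h]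

lemma isState_ketbra {ψ : Hilb d} (h : ‖ψ‖ = 1) : IsState (ketbra ψ ψ) :=
  ⟨posSemidef_ketbra ψ, by rw [trace_ketbra, inner_self_of_norm_one h]⟩

lemma PosSemidef.inner_nonneg {ρ : Op d} (hρ : ρ.PosSemidef) (v : Hilb d) :
    0 ≤ inner ℂ v (toEuclideanLin ρ v) :=
  (Matrix.isPositive_toEuclideanLin_iff.mpr hρ).inner_nonneg_right v

lemma PosSemidef.inner_eq_zero_iff {ρ : Op d} (hρ : ρ.PosSemidef) (v : Hilb d) :
    inner ℂ v (toEuclideanLin ρ v) = 0 ↔ toEuclideanLin ρ v = 0 := by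
  refine ⟨fun h => ?_, fun h => by rw [h, inner_zero_right]⟩
  rw [EuclideanSpace.inner_eq_star_dotProduct, dotProduct_comm] at h
  rw [Matrix.toLpLin_apply, (hρ.dotProduct_mulVec_zero_iff _).mp h]
  rfl

/-! ### Supports -/

/-- In an orthonormal eigenbasis, the eigenvectors with eigenvalue zero span the kernel and the
others the support. Supports are handled below through kernels. -/
lemma mem_supp_iff {ρ : Op d} (hρ : ρ.PosSemidef) (v : Hilb d) :
    v ∈ supp ρ ↔ ∀ w, toEuclideanLin ρ w = 0 → inner ℂ w v = 0 := by
  have hpos := Matrix.isPositive_toEuclideanLin_iff.mpr hρ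
  have hsym := hpos.isSymmetric
  constructor
  · intro hv w hw
    induction hv using Submodule.span_induction with
    | mem v hv =>
      obtain ⟨p, hp, hv⟩ := hv
      have h := hsym w v
      rw [hw, hv, inner_zero_left, inner_smul_right] at h
      exact (mul_eq_zero.mp h.symm).resolve_left (by exact_mod_cast hp.ne')
    | zero => exact inner_zero_right _
    | add x y _ _ hx hy => rw [inner_add_right, hx, hy, add_zero]
    | smul c x _ hx => rw [inner_smul_right, hx, mul_zero]
  · intro h
    let b := hsym.eigenvectorBasis finrank_euclideanSpace
    rw [← b.sum_repr' v]
    refine Submodule.sum_mem _ fun i _ => ?_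
    have hb : toEuclideanLin ρ (b i) = (hsym.eigenvalues finrank_euclideanSpace i : ℂ) • b i :=
      hsym.apply_eigenvectorBasis finrank_euclideanSpace i
    rcases (hpos.nonneg_eigenvalues finrank_euclideanSpace i).lt_or_eq with hi | hi
    · exact Submodule.smul_mem _ _ (Submodule.subset_span ⟨_, hi, hb⟩)
    · rw [h (b i) (by rw [hb, ← hi]; simp), zero_smul]
      exact Submodule.zero_mem _

lemma krausMap_apply (K : Fin m → Op d) (ρ : Op d) :
    krausMap K ρ = ∑ i, K i * ρ * (K i)ᴴ := by
  simp [krausMap, mul_assoc]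

lemma posSemidef_krausMap (K : Fin m → Op d) {ρ : Op d} (hρ : ρ.PosSemidef) :
    (krausMap K ρ).PosSemidef := by
  rw [krausMap_apply]
  exact Matrix.posSemidef_sum _ fun i _ => hρ.mul_mul_conjTranspose_same _

lemma trace_krausMap {K : Fin m → Op d} (hK : IsKraus K) (ρ : Op d) :
    (krausMap K ρ).trace = ρ.trace := by
  rw [krausMap_apply, Matrix.trace_sum]
  simp_rw [fun i => Matrix.trace_mul_comm (K i * ρ) (K i)ᴴ, ← mul_assoc]
  rw [← Matrix.trace_sum, ← Finset.sum_mul, hK, one_mul]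

lemma isState_krausMap {K : Fin m → Op d} (hK : IsKraus K) {ρ : Op d} (hρ : IsState ρ) :
    IsState (krausMap K ρ) :=
  ⟨posSemidef_krausMap K hρ.1, by rw [trace_krausMap hK, hρ.2]⟩

lemma inner_krausMap (K : Fin m → Op d) (ρ : Op d) (w : Hilb d) :
    inner ℂ w (toEuclideanLin (krausMap K ρ) w) =
      ∑ i, inner ℂ (toEuclideanLin (K i)ᴴ w) (toEuclideanLin ρ (toEuclideanLin (K i)ᴴ w)) := by
  rw [krausMap_apply, toEuclideanLin_sum_apply, inner_sum]
  refine Finset.sum_congr rfl fun i _ => ?_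
  rw [toEuclideanLin_mul_apply, toEuclideanLin_mul_apply, inner_toEuclideanLin_right]

/-- The quadratic form of the output at `w` is a sum of nonnegative terms, the forms of `ρ` at `(K
i)ᴴ w`; it vanishes only if each term does. -/
lemma krausMap_ker {K : Fin m → Op d} {ρ : Op d} (hρ : ρ.PosSemidef) (w : Hilb d) :
    toEuclideanLin (krausMap K ρ) w = 0 ↔
      ∀ i, toEuclideanLin ρ (toEuclideanLin (K i)ᴴ w) = 0 := by
  rw [← PosSemidef.inner_eq_zero_iff (posSemidef_krausMap K hρ), inner_krausMap,
    Finset.sum_eq_zero_iff_of_nonneg fun i _ => PosSemidef.inner_nonneg hρ _]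
  simp only [Finset.mem_univ, true_imp_iff, PosSemidef.inner_eq_zero_iff hρ]

lemma ketbra_ker {ψ w : Hilb d} :
    toEuclideanLin (ketbra ψ ψ) w = 0 ↔ inner ℂ ψ w = 0 := by
  rw [toEuclideanLin_ketbra, smul_eq_zero]
  refine ⟨fun h => h.elim id fun h => by rw [h, inner_zero_left], Or.inl⟩

lemma krausMap_ketbra_ker {K : Fin m → Op d} {ψ w : Hilb d} :
    toEuclideanLin (krausMap K (ketbra ψ ψ)) w = 0 ↔
      ∀ i, inner ℂ (toEuclideanLin (K i) ψ) w = 0 := by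
  simp_rw [krausMap_ker (posSemidef_ketbra ψ), ketbra_ker, inner_toEuclideanLin_left]

/-- The span of the images of a vector under the Kraus operators. -/
def krausSpan (K : Fin m → Op d) (ψ : Hilb d) : Submodule ℂ (Hilb d) :=
  Submodule.span ℂ (Set.range fun i => toEuclideanLin (K i) ψ)

lemma mem_krausSpan_orthogonal {K : Fin m → Op d} {ψ w : Hilb d} :
    w ∈ (krausSpan K ψ)ᗮ ↔ ∀ i, inner ℂ (toEuclideanLin (K i) ψ) w = 0 := by
  rw [krausSpan, Submodule.mem_orthogonal]
  constructor
  · exact fun h i => h _ (Submodule.subset_span ⟨i, rfl⟩)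
  · intro h u hu
    induction hu using Submodule.span_induction with
    | mem v hv => obtain ⟨i, rfl⟩ := hv; exact h i
    | zero => exact inner_zero_left _
    | add x y _ _ hx hy => rw [inner_add_left, hx, hy, add_zero]
    | smul c x _ hx => rw [inner_smul_left, hx, mul_zero]

lemma supp_krausMap_ketbra (K : Fin m → Op d) (ψ : Hilb d) :
    supp (krausMap K (ketbra ψ ψ)) = krausSpan K ψ := by
  ext v
  rw [mem_supp_iff (posSemidef_krausMap K (posSemidef_ketbra ψ)),
    ← Submodule.orthogonal_orthogonal (krausSpan K ψ), Submodule.mem_orthogonal]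
  simp_rw [krausMap_ketbra_ker, mem_krausSpan_orthogonal]

lemma mem_supp_ketbra {ψ v : Hilb d} : v ∈ supp (ketbra ψ ψ) ↔ ∃ c : ℂ, c • ψ = v := by
  rw [mem_supp_iff (posSemidef_ketbra ψ), ← Submodule.mem_span_singleton,
    ← Submodule.orthogonal_orthogonal (Submodule.span ℂ {ψ}), Submodule.mem_orthogonal]
  simp_rw [ketbra_ker, Submodule.mem_orthogonal_singleton_iff_inner_right]

lemma self_mem_supp_ketbra (ψ : Hilb d) : ψ ∈ supp (ketbra ψ ψ) :=
  mem_supp_ketbra.mpr ⟨1, one_smul _ _⟩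

/-- The outputs of the pure states of the support lie in the support of the output. -/
lemma krausSpan_le_supp {K : Fin m → Op d} {ρ : Op d} (hρ : ρ.PosSemidef) {ψ : Hilb d}
    (hψ : ψ ∈ supp ρ) : krausSpan K ψ ≤ supp (krausMap K ρ) := by
  refine Submodule.span_le.mpr ?_
  rintro _ ⟨i, rfl⟩
  refine (mem_supp_iff (posSemidef_krausMap K hρ) _).mpr fun w hw => ?_
  rw [inner_toEuclideanLin_right]
  exact (mem_supp_iff hρ ψ).mp hψ _ ((krausMap_ker hρ w).mp hw i)

/-- A state whose support is contained in a subspace vanishes on the orthogonal complement. -/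
lemma ker_of_supp_le {ρ : Op d} (hρ : ρ.PosSemidef) {S : Submodule ℂ (Hilb d)} (h : supp ρ ≤ S)
    {w : Hilb d} (hw : w ∈ Sᗮ) : toEuclideanLin ρ w = 0 := by
  rw [← PosSemidef.inner_eq_zero_iff hρ, ← inner_conj_symm]
  have hmem : toEuclideanLin ρ w ∈ supp ρ := by
    refine (mem_supp_iff hρ _).mpr fun u hu => ?_
    rw [inner_toEuclideanLin_right, hρ.1.eq, hu, inner_zero_left]
  rw [(Submodule.mem_orthogonal S w).mp hw _ (h hmem), map_zero]

lemma exists_unit_mem_supp {ρ : Op d} (hρ : IsState ρ) : ∃ v ∈ supp ρ, ‖v‖ = 1 := by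
  have hne : ∃ v ∈ supp ρ, v ≠ 0 := by
    by_contra! h
    have h0 : ρ = 0 := op_ext fun w => by
      rw [ker_of_supp_le hρ.1 (S := ⊥) (fun v hv => by simpa using h v hv) (by simp)]; simp
    have := hρ.2
    simp [h0] at this
  obtain ⟨v, hv, hv0⟩ := hne
  exact ⟨((‖v‖ : ℂ)⁻¹) • v, Submodule.smul_mem _ _ hv, by
    rw [norm_smul, norm_inv, Complex.norm_real, norm_norm, inv_mul_cancel₀ (norm_ne_zero_iff.mpr hv0)]⟩

/-! ### The maximal fidelity of a pure state and its output -/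

lemma inner_eq_inner_starProjection {S : Submodule ℂ (Hilb d)} {v : Hilb d} (hv : v ∈ S)
    (ψ : Hilb d) : inner ℂ v ψ = inner ℂ v (S.starProjection ψ) := by
  rw [← Submodule.inner_starProjection_left_eq_right, Submodule.starProjection_eq_self_iff.mpr hv]

lemma norm_inner_le_norm_starProjection {S : Submodule ℂ (Hilb d)} {v : Hilb d} (hv : v ∈ S)
    (ψ : Hilb d) : ‖inner ℂ v ψ‖ ≤ ‖v‖ * ‖S.starProjection ψ‖ := by
  rw [inner_eq_inner_starProjection hv]
  exact norm_inner_le_norm _ _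

lemma norm_smul_inv_norm_self {v : Hilb d} (hv : v ≠ 0) : ‖((‖v‖ : ℂ)⁻¹) • v‖ = 1 := by
  rw [norm_smul, norm_inv, Complex.norm_real, norm_norm, inv_mul_cancel₀ (norm_ne_zero_iff.mpr hv)]

lemma norm_smul_smul_inv_norm_self (v : Hilb d) : (‖v‖ : ℂ) • ((‖v‖ : ℂ)⁻¹) • v = v := by
  rcases eq_or_ne v 0 with rfl | hv
  · simp
  · rw [smul_smul, mul_inv_cancel₀ (by simpa using hv), one_smul]

/-- The projection to a nonzero subspace is a multiple of a unit vector of the subspace. -/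
lemma exists_unit_starProjection {S : Submodule ℂ (Hilb d)} (hS : ∃ v ∈ S, ‖v‖ = 1)
    (ψ : Hilb d) : ∃ v ∈ S, ‖v‖ = 1 ∧ S.starProjection ψ = (‖S.starProjection ψ‖ : ℂ) • v := by
  by_cases h : S.starProjection ψ = 0
  · obtain ⟨v, hv, hv1⟩ := hS
    exact ⟨v, hv, hv1, by simp [h]⟩
  · exact ⟨_, S.smul_mem _ (S.starProjection_apply_mem ψ), norm_smul_inv_norm_self h,
      (norm_smul_smul_inv_norm_self _).symm⟩

lemma exists_unit_inner_eq_norm_starProjection {S : Submodule ℂ (Hilb d)}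
    (hS : ∃ v ∈ S, ‖v‖ = 1) (ψ : Hilb d) :
    ∃ v ∈ S, ‖v‖ = 1 ∧ inner ℂ v ψ = (‖S.starProjection ψ‖ : ℂ) := by
  obtain ⟨v, hv, hv1, h⟩ := exists_unit_starProjection hS ψ
  refine ⟨v, hv, hv1, ?_⟩
  rw [inner_eq_inner_starProjection hv, h, inner_smul_right, inner_self_of_norm_one hv1, mul_one,
    ← h]

/-- Removes the projection, which varies badly with `S`, in favour of one inequality for each vector
of `S`. -/
lemma norm_starProjection_le_iff {S : Submodule ℂ (Hilb d)} {ψ : Hilb d} {r : ℝ} (hr : 0 ≤ r) :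
    ‖S.starProjection ψ‖ ≤ r ↔ ∀ v ∈ S, ‖inner ℂ v ψ‖ ≤ ‖v‖ * r := by
  constructor
  · exact fun h v hv => (norm_inner_le_norm_starProjection hv ψ).trans
      (mul_le_mul_of_nonneg_left h (norm_nonneg _))
  · intro h
    by_cases h0 : S.starProjection ψ = 0
    · simpa [h0] using hr
    · obtain ⟨v, hv, hv1, hin⟩ := exists_unit_inner_eq_norm_starProjection
        ⟨_, S.smul_mem _ (S.starProjection_apply_mem ψ), norm_smul_inv_norm_self h0⟩ ψ
      simpa [hv1, hin] using h v hv

/-- The norm of the projection of `ψ` to the span of its images under the Kraus operators. -/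
noncomputable def krausFidelity (K : Fin m → Op d) (ψ : Hilb d) : ℝ :=
  ‖(krausSpan K ψ).starProjection ψ‖

lemma krausFidelity_nonneg (K : Fin m → Op d) (ψ : Hilb d) : 0 ≤ krausFidelity K ψ :=
  norm_nonneg _

lemma exists_unit_mem_krausSpan {K : Fin m → Op d} (hK : IsKraus K) {ψ : Hilb d} (hψ : ‖ψ‖ = 1) :
    ∃ v ∈ krausSpan K ψ, ‖v‖ = 1 := by
  rw [← supp_krausMap_ketbra]
  exact exists_unit_mem_supp (isState_krausMap hK (isState_ketbra hψ))

lemma maxFidelity_krausMap_ketbra {K : Fin m → Op d} (hK : IsKraus K) {ψ : Hilb d}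
    (hψ : ‖ψ‖ = 1) :
    maxFidelity (krausMap K (ketbra ψ ψ)) (ketbra ψ ψ) = krausFidelity K ψ := by
  rw [maxFidelity, supp_krausMap_ketbra]
  refine IsGreatest.csSup_eq ⟨?_, ?_⟩
  · obtain ⟨v, hv, hv1, h⟩ :=
      exists_unit_inner_eq_norm_starProjection (exists_unit_mem_krausSpan hK hψ) ψ
    refine ⟨v, hv, ψ, self_mem_supp_ketbra ψ, hv1, hψ, ?_⟩
    rw [h, Complex.norm_real, norm_norm, krausFidelity]
  · rintro _ ⟨v, hv, φ, hφ, hv1, hφ1, rfl⟩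
    obtain ⟨c, rfl⟩ := mem_supp_ketbra.mp hφ
    rw [norm_smul, hψ, mul_one] at hφ1
    rw [inner_smul_right, norm_mul, hφ1, one_mul]
    simpa [hv1, krausFidelity] using norm_inner_le_norm_starProjection hv ψ

lemma mem_fidelitySet_one_iff {K : Fin m → Op d} (hK : IsKraus K) {r : ℝ} :
    r ∈ fidelitySet 1 (krausMap K) LinearMap.id ↔ ∃ ψ : Hilb d, ‖ψ‖ = 1 ∧ r = krausFidelity K ψ := by
  constructor
  · rintro ⟨ψ, φ, hψ, hφ, h, rfl⟩
    obtain rfl := (inner_eq_one_iff_of_norm_eq_one hψ hφ).mp (by simpa using h)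
    exact ⟨ψ, hψ, by rw [LinearMap.id_apply, maxFidelity_krausMap_ketbra hK hψ]⟩
  · rintro ⟨ψ, hψ, rfl⟩
    exact ⟨ψ, ψ, hψ, hψ, by simpa using inner_self_of_norm_one hψ,
      by rw [LinearMap.id_apply, maxFidelity_krausMap_ketbra hK hψ]⟩

/-! ### The minimum of the fidelity is attained -/

/-- The dimension of `krausSpan K ψ` can drop, so the fidelity need not be continuous. But each
fixed choice of coefficients gives a vector of the span that is continuous in `ψ`, hence a closed
condition. -/
lemma isClosed_krausFidelity_le (K : Fin m → Op d) (r : ℝ) :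
    IsClosed {ψ | krausFidelity K ψ ≤ r} := by
  rcases lt_or_ge r 0 with hr | hr
  · convert isClosed_empty
    ext ψ
    simpa using hr.trans_le (krausFidelity_nonneg K ψ)
  · have h : {ψ | krausFidelity K ψ ≤ r} = ⋂ c : Fin m → ℂ,
        {ψ | ‖inner ℂ (∑ i, c i • toEuclideanLin (K i) ψ) ψ‖ ≤
          ‖∑ i, c i • toEuclideanLin (K i) ψ‖ * r} := by
      ext ψ
      simp only [Set.mem_ofPred_eq, Set.mem_iInter, krausFidelity, norm_starProjection_le_iff hr,
        krausSpan, Submodule.mem_span_range_iff_exists_fun]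
      exact ⟨fun h c => h _ ⟨c, rfl⟩, by rintro h _ ⟨c, rfl⟩; exact h c⟩
    rw [h]
    refine isClosed_iInter fun c => ?_
    have hc : Continuous fun ψ : Hilb d => ∑ i, c i • toEuclideanLin (K i) ψ :=
      continuous_finsetSum _ fun i _ => by
        have := (toEuclideanLin (K i)).continuous_of_finiteDimensional
        fun_prop
    exact isClosed_le (hc.inner continuous_id).norm (hc.norm.mul continuous_const)

lemma exists_min_krausFidelity (hd : 0 < d) (K : Fin m → Op d) :
    ∃ b : Hilb d, ‖b‖ = 1 ∧ ∀ ψ : Hilb d, ‖ψ‖ = 1 → krausFidelity K b ≤ krausFidelity K ψ := by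
  have hne : (Metric.sphere (0 : Hilb d) 1).Nonempty :=
    ⟨EuclideanSpace.single ⟨0, hd⟩ 1, by simp⟩
  have hlsc : LowerSemicontinuousOn (krausFidelity K) (Metric.sphere (0 : Hilb d) 1) :=
    lowerSemicontinuousOn_iff_preimage_Iic.mpr fun r =>
      ⟨_, isClosed_krausFidelity_le K r, rfl⟩
  obtain ⟨b, hb, hmin⟩ := hlsc.exists_isMinOn hne (isCompact_sphere _ _)
  exact ⟨b, by simpa using hb, fun ψ hψ => hmin (by simpa using hψ)⟩

lemma isLeast_fidelitySet {K : Fin m → Op d} (hK : IsKraus K) {b : Hilb d} (hb : ‖b‖ = 1)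
    (hmin : ∀ ψ : Hilb d, ‖ψ‖ = 1 → krausFidelity K b ≤ krausFidelity K ψ) :
    IsLeast (fidelitySet 1 (krausMap K) LinearMap.id) (krausFidelity K b) := by
  refine ⟨(mem_fidelitySet_one_iff hK).mpr ⟨b, hb, rfl⟩, fun r hr => ?_⟩
  obtain ⟨ψ, hψ, rfl⟩ := (mem_fidelitySet_one_iff hK).mp hr
  exact hmin ψ hψ

/-! ### The lower bound on the number of queries -/

/-- Split `u` and `w` along `v`: the components along `v` give the product of cosines, and
Cauchy-Schwarz bounds the remainders by the product of sines. -/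
lemma norm_inner_ge_of_unit {u v w : Hilb d} (hu : ‖u‖ = 1) (hv : ‖v‖ = 1) (hw : ‖w‖ = 1) :
    ‖inner ℂ u v‖ * ‖inner ℂ v w‖ -
      √(1 - ‖inner ℂ u v‖ ^ 2) * √(1 - ‖inner ℂ v w‖ ^ 2) ≤ ‖inner ℂ u w‖ := by
  have hvv := inner_self_of_norm_one hv
  have key : ∀ x : Hilb d, ‖x‖ = 1 →
      ‖x - inner ℂ v x • v‖ = √(1 - ‖inner ℂ v x‖ ^ 2) := by
    intro x hx
    have h : ‖x‖ ^ 2 = ‖inner ℂ v x • v‖ ^ 2 + ‖x - inner ℂ v x • v‖ ^ 2 := by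
      have := norm_add_sq_eq_norm_sq_add_norm_sq_of_inner_eq_zero (𝕜 := ℂ) (inner ℂ v x • v)
        (x - inner ℂ v x • v) (by
          rw [inner_smul_left, inner_sub_right, inner_smul_right, hvv, mul_one, sub_self, mul_zero])
      simpa [sq] using this
    rw [norm_smul, hx, hv] at h
    rw [← Real.sqrt_sq (norm_nonneg (x - _))]
    congr 1
    linarith
  have hsplit : inner ℂ u w = inner ℂ u v * inner ℂ v w +
      inner ℂ (u - inner ℂ v u • v) (w - inner ℂ v w • v) := by
    simp only [inner_sub_left, inner_sub_right, inner_smul_left, inner_smul_right, hvv,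
      inner_conj_symm]
    ring
  have hcs := norm_inner_le_norm (𝕜 := ℂ) (u - inner ℂ v u • v) (w - inner ℂ v w • v)
  rw [key u hu, key w hw, norm_inner_symm v u] at hcs
  rw [hsplit]
  have := norm_sub_le_norm_add (inner ℂ u v * inner ℂ v w)
    (inner ℂ (u - inner ℂ v u • v) (w - inner ℂ v w • v))
  rw [norm_mul] at this
  linarith

/-- The triangle inequality for the angle between the rays of unit vectors. -/
lemma cos_add_le_norm_inner {u v w : Hilb d} (hu : ‖u‖ = 1) (hv : ‖v‖ = 1) (hw : ‖w‖ = 1)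
    {α β : ℝ} (hα : 0 ≤ α) (hβ : 0 ≤ β) (h : α + β ≤ Real.pi / 2)
    (huv : Real.cos α ≤ ‖inner ℂ u v‖) (hvw : Real.cos β ≤ ‖inner ℂ v w‖) :
    Real.cos (α + β) ≤ ‖inner ℂ u w‖ := by
  refine le_trans ?_ (norm_inner_ge_of_unit hu hv hw)
  have hcα : 0 ≤ Real.cos α := Real.cos_nonneg_of_mem_Icc ⟨by linarith, by linarith⟩
  have hcβ : 0 ≤ Real.cos β := Real.cos_nonneg_of_mem_Icc ⟨by linarith, by linarith⟩
  have hsin : ∀ {γ x : ℝ}, 0 ≤ γ → γ ≤ Real.pi / 2 → Real.cos γ ≤ x →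
      √(1 - x ^ 2) ≤ Real.sin γ := by
    intro γ x h0 h1 hx
    have hc : 0 ≤ Real.cos γ := Real.cos_nonneg_of_mem_Icc ⟨by linarith, by linarith⟩
    refine Real.sqrt_le_iff.mpr ⟨Real.sin_nonneg_of_nonneg_of_le_pi h0 (by linarith), ?_⟩
    nlinarith [Real.sin_sq_add_cos_sq γ]
  rw [Real.cos_add]
  have h1 := mul_le_mul huv hvw hcβ (norm_nonneg _)
  have h2 := mul_le_mul (hsin hα (by linarith) huv) (hsin hβ (by linarith) hvw)
    (Real.sqrt_nonneg _) (Real.sin_nonneg_of_nonneg_of_le_pi hα (by linarith))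
  linarith

lemma sum_norm_sq_kraus {K : Fin m → Op d} (hK : IsKraus K) (ψ : Hilb d) :
    ∑ i, ‖toEuclideanLin (K i) ψ‖ ^ 2 = ‖ψ‖ ^ 2 := by
  have h : ∑ i, inner ℂ (toEuclideanLin (K i) ψ) (toEuclideanLin (K i) ψ) = inner ℂ ψ ψ := by
    simp_rw [inner_toEuclideanLin_left, ← toEuclideanLin_mul_apply]
    rw [← inner_sum, ← toEuclideanLin_sum_apply, hK, toEuclideanLin_one_apply]
  simp_rw [inner_self_eq_norm_sq_to_K] at h
  exact_mod_cast h

lemma sum_inner_kraus {K : Fin m → Op d} (hK : IsKraus K) (ψ φ : Hilb d) :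
    ∑ i, inner ℂ (toEuclideanLin (K i) ψ) (toEuclideanLin (K i) φ) = inner ℂ ψ φ := by
  simp_rw [inner_toEuclideanLin_left, ← toEuclideanLin_mul_apply]
  rw [← inner_sum, ← toEuclideanLin_sum_apply, hK, toEuclideanLin_one_apply]

/-- A quantum operation does not decrease the overlap of two pure states. -/
lemma exists_unit_krausSpan_norm_inner_ge {K : Fin m → Op d} (hK : IsKraus K) {ψ φ : Hilb d}
    (hψ : ‖ψ‖ = 1) (hφ : ‖φ‖ = 1) (h0 : inner ℂ ψ φ ≠ 0) :
    ∃ v ∈ krausSpan K ψ, ∃ w ∈ krausSpan K φ, ‖v‖ = 1 ∧ ‖w‖ = 1 ∧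
      ‖inner ℂ ψ φ‖ ≤ ‖inner ℂ v w‖ := by
  set c := ‖inner ℂ ψ φ‖ with hc
  have hc0 : 0 < c := norm_pos_iff.mpr h0
  suffices h : ∃ i, toEuclideanLin (K i) ψ ≠ 0 ∧ toEuclideanLin (K i) φ ≠ 0 ∧
      c * (‖toEuclideanLin (K i) ψ‖ * ‖toEuclideanLin (K i) φ‖) ≤
        ‖inner ℂ (toEuclideanLin (K i) ψ) (toEuclideanLin (K i) φ)‖ by
    obtain ⟨i, hx, hy, hi⟩ := h
    refine ⟨_, Submodule.smul_mem _ _ (Submodule.subset_span ⟨i, rfl⟩),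
      _, Submodule.smul_mem _ _ (Submodule.subset_span ⟨i, rfl⟩),
      norm_smul_inv_norm_self hx, norm_smul_inv_norm_self hy, ?_⟩
    simp only [inner_smul_left, inner_smul_right, norm_mul, map_inv₀, Complex.conj_ofReal, norm_inv,
      Complex.norm_real, norm_norm]
    have hx' := norm_pos_iff.mpr hx
    have hy' := norm_pos_iff.mpr hy
    rw [← mul_assoc, ← mul_inv, mul_comm, ← div_eq_mul_inv, le_div_iff₀ (by positivity)]
    rwa [mul_comm ‖toEuclideanLin (K i) φ‖]
  -- Otherwise `c = |∑ ⟨x i, y i⟩| < c ∑ ‖x i‖‖y i‖ ≤ c`, the last step because the squared norms of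
  -- the `x i`, and of the `y i`, sum to one. Strictness needs an index with `⟨x i, y i⟩ ≠ 0`, which
  -- exists since `c > 0`.
  by_contra! hcon
  set x := fun i => toEuclideanLin (K i) ψ with hx
  set y := fun i => toEuclideanLin (K i) φ with hy
  have hle : ∀ i, ‖inner ℂ (x i) (y i)‖ ≤ c * (‖x i‖ * ‖y i‖) := by
    intro i
    by_cases h1 : x i = 0
    · simp [h1]
    by_cases h2 : y i = 0
    · simp [h2]
    exact (hcon i h1 h2).le
  have hex : ∃ i, inner ℂ (x i) (y i) ≠ 0 := by
    by_contra! h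
    exact h0 (by rw [← sum_inner_kraus hK]; exact Finset.sum_eq_zero fun i _ => h i)
  obtain ⟨i, hi⟩ := hex
  have hlt : ‖inner ℂ (x i) (y i)‖ < c * (‖x i‖ * ‖y i‖) :=
    hcon i (fun h => hi (by simp only [hx]; rw [h, inner_zero_left]))
      (fun h => hi (by simp only [hy]; rw [h, inner_zero_right]))
  have h1 : c < ∑ i, c * (‖x i‖ * ‖y i‖) := by
    have hsum : c = ‖∑ i, inner ℂ (x i) (y i)‖ := by rw [hc, ← sum_inner_kraus hK]
    refine hsum.trans_lt ((norm_sum_le _ _).trans_lt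
      (Finset.sum_lt_sum (fun i _ => hle i) ⟨i, Finset.mem_univ _, hlt⟩))
  have h2 : ∑ i, ‖x i‖ * ‖y i‖ ≤ 1 := by
    have h3 : ∑ i, 2 * (‖x i‖ * ‖y i‖) ≤ ∑ i, (‖x i‖ ^ 2 + ‖y i‖ ^ 2) :=
      Finset.sum_le_sum fun i _ => by nlinarith [sq_nonneg (‖x i‖ - ‖y i‖)]
    rw [← Finset.mul_sum, Finset.sum_add_distrib, sum_norm_sq_kraus hK, sum_norm_sq_kraus hK, hψ,
      hφ] at h3
    linarith
  rw [← Finset.mul_sum] at h1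
  nlinarith

lemma isState_seqState {X : Op d →ₗ[ℂ] Op d} (hX : IsQuantumOperation X) {ρ : Op d}
    (hρ : IsState ρ) {T : ℕ → Op d →ₗ[ℂ] Op d} (hT : ∀ k, IsQuantumOperation (T k)) (n : ℕ) :
    IsState (seqState X ρ T n) := by
  have key : ∀ {Y : Op d →ₗ[ℂ] Op d}, IsQuantumOperation Y → ∀ {σ : Op d}, IsState σ →
      IsState (Y σ) := by
    rintro _ ⟨m, K, hK, rfl⟩ σ hσ
    exact isState_krausMap hK hσ
  induction n with
  | zero => exact hρ
  | succ n ih => exact key hX (key (hT n) ih)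

lemma isKraus_one : IsKraus fun _ : Fin 1 => (1 : Op d) := by
  simp [IsKraus]

lemma isQuantumOperation_id : IsQuantumOperation (LinearMap.id : Op d →ₗ[ℂ] Op d) :=
  ⟨1, fun _ => 1, isKraus_one, LinearMap.ext fun ρ => by simp [krausMap_apply]⟩

/-- The invariant of the lower bound: `T n` preserves the overlap bound, and the query replaces the
first vector by its normalized projection to its Kraus span, at angle at most `θ`. The strict bound
on `n * θ` keeps the overlap nonzero. -/
lemma exists_unit_supp_seqState {K : Fin m → Op d} (hK : IsKraus K) {θ : ℝ} (hθ : 0 ≤ θ)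
    (hmin : ∀ ψ : Hilb d, ‖ψ‖ = 1 → Real.cos θ ≤ krausFidelity K ψ) {ρ : Op d}
    (hρ : IsState ρ) {T : ℕ → Op d →ₗ[ℂ] Op d} (hT : ∀ k, IsQuantumOperation (T k)) (n : ℕ)
    (hn : n * θ < Real.pi / 2) :
    ∃ ψ ∈ supp (seqState (krausMap K) ρ T n), ∃ φ ∈ supp (seqState LinearMap.id ρ T n),
      ‖ψ‖ = 1 ∧ ‖φ‖ = 1 ∧ Real.cos (n * θ) ≤ ‖inner ℂ ψ φ‖ := by
  induction n with
  | zero =>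
    obtain ⟨v, hv, hv1⟩ := exists_unit_mem_supp hρ
    exact ⟨v, hv, v, hv, hv1, hv1, by
      rw [inner_self_of_norm_one hv1]; simp⟩
  | succ n ih =>
    push_cast at hn ⊢
    rw [add_mul, one_mul] at hn ⊢
    obtain ⟨ψ, hψ, φ, hφ, hψ1, hφ1, hle⟩ := ih (by linarith)
    have hn0 : 0 ≤ n * θ := by positivity
    have hcos : 0 < Real.cos (n * θ) := Real.cos_pos_of_mem_Ioo ⟨by linarith, by linarith⟩
    have hs0 := isState_seqState ⟨m, K, hK, rfl⟩ hρ hT n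
    have hs1 := isState_seqState isQuantumOperation_id hρ hT n
    obtain ⟨m', L, hL, hTL⟩ := hT n
    obtain ⟨v, hv, w, hw, hv1, hw1, hvw⟩ := exists_unit_krausSpan_norm_inner_ge hL hψ1 hφ1
      (norm_pos_iff.mp (hcos.trans_le hle))
    obtain ⟨u, hu, hu1, huv⟩ :=
      exists_unit_inner_eq_norm_starProjection (exists_unit_mem_krausSpan hK hv1) v
    refine ⟨u, ?_, w, ?_, hu1, hw1, ?_⟩
    · rw [seqState, hTL]
      exact krausSpan_le_supp (posSemidef_krausMap L hs0.1) (krausSpan_le_supp hs0.1 hψ hv) hu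
    · rw [seqState, hTL]
      exact krausSpan_le_supp hs1.1 hφ hw
    · rw [add_comm]
      refine cos_add_le_norm_inner hu1 hv1 hw1 hθ hn0 (by linarith) ?_ (hle.trans hvw)
      rw [huv, Complex.norm_real, norm_norm]
      exact hmin v hv1

/-- `P ρ P` is positive of trace zero, hence zero, so the form of `ρ` vanishes at every `P v`. -/
lemma mulVec_eq_zero_of_trace_eq_zero {ρ P : Op d} (hρ : ρ.PosSemidef) (hP : P.IsHermitian)
    (hPP : P * P = P) (h : (P * ρ).trace = 0) (v : Hilb d) :
    toEuclideanLin ρ (toEuclideanLin P v) = 0 := by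
  have hps := hρ.mul_mul_conjTranspose_same P
  have h0 : P * ρ * Pᴴ = 0 := by
    rw [← hps.trace_eq_zero_iff, hP.eq, Matrix.trace_mul_comm, ← mul_assoc, hPP, h]
  rw [← PosSemidef.inner_eq_zero_iff hρ, inner_toEuclideanLin_left, ← toEuclideanLin_mul_apply,
    ← toEuclideanLin_mul_apply, hP.eq]
  rw [hP.eq] at h0
  simp [h0]

/-- The supports of perfectly distinguishable states are orthogonal. -/
lemma inner_eq_zero_of_perfectlyDistinguishable {ρ σ : Op d} (hρ : IsState ρ) (hσ : IsState σ)
    (h : PerfectlyDistinguishable ρ σ) {v w : Hilb d} (hv : v ∈ supp ρ) (hw : w ∈ supp σ) :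
    inner ℂ v w = 0 := by
  obtain ⟨P, hP, hPP, h1, h0⟩ := h
  have hPw : toEuclideanLin P w = 0 := by
    refine ext_inner_left ℂ fun u => ?_
    rw [inner_zero_right, inner_toEuclideanLin_right, hP.eq]
    exact (mem_supp_iff hσ.1 w).mp hw _ (mulVec_eq_zero_of_trace_eq_zero hσ.1 hP hPP h0 u)
  have hQ : (1 - P).IsHermitian := Matrix.isHermitian_one.sub hP
  have hPv : toEuclideanLin (1 - P) v = 0 := by
    refine ext_inner_left ℂ fun u => ?_
    rw [inner_zero_right, inner_toEuclideanLin_right, hQ.eq]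
    refine (mem_supp_iff hρ.1 v).mp hv _ (mulVec_eq_zero_of_trace_eq_zero hρ.1 hQ ?_ ?_ u)
    · rw [mul_sub, sub_mul, sub_mul, hPP]; simp
    · rw [sub_mul, one_mul, Matrix.trace_sub, hρ.2, h1, sub_self]
  rw [map_sub, LinearMap.sub_apply, toEuclideanLin_one_apply, sub_eq_zero] at hPv
  rw [hPv, inner_toEuclideanLin_left, hP.eq, hPw, inner_zero_right]

lemma pi_div_two_le_of_seqDistinguishableIn {K : Fin m → Op d} (hK : IsKraus K) {θ : ℝ}
    (hθ : 0 ≤ θ) (hmin : ∀ ψ : Hilb d, ‖ψ‖ = 1 → Real.cos θ ≤ krausFidelity K ψ) {n : ℕ}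
    (h : SeqDistinguishableIn (krausMap K) LinearMap.id n) : Real.pi / 2 ≤ n * θ := by
  obtain ⟨ρ, T, hρ, hT, hdist⟩ := h
  by_contra! hn
  obtain ⟨ψ, hψ, φ, hφ, -, -, hle⟩ := exists_unit_supp_seqState hK hθ hmin hρ hT n hn
  have hn0 : 0 ≤ n * θ := by positivity
  rw [inner_eq_zero_of_perfectlyDistinguishable (isState_seqState ⟨m, K, hK, rfl⟩ hρ hT n)
    (isState_seqState isQuantumOperation_id hρ hT n) hdist hψ hφ, norm_zero] at hle
  exact hle.not_gt (Real.cos_pos_of_mem_Ioo ⟨by linarith, by linarith⟩)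

/-! ### Transformation of a subspace and a vector to two pure states -/

lemma ketbra_mul_ketbra (a b c e : Hilb d) :
    ketbra a b * ketbra c e = inner ℂ b c • ketbra a e :=
  op_ext fun v => by
    rw [toEuclideanLin_mul_apply, map_smul, LinearMap.smul_apply, toEuclideanLin_ketbra,
      toEuclideanLin_ketbra, toEuclideanLin_ketbra, inner_smul_right, smul_smul, mul_comm]

/-- A contraction, completed by operators that prepare a fixed pure state, is an operation. -/
lemma exists_quantumOperation_of_contraction {A : Op d} (hA : (1 - Aᴴ * A).PosSemidef)
    {b : Hilb d} (hb : ‖b‖ = 1) :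
    ∃ T : Op d →ₗ[ℂ] Op d, IsQuantumOperation T ∧
      ∀ ρ, T ρ = A * ρ * Aᴴ + ((1 - Aᴴ * A) * ρ).trace • ketbra b b := by
  obtain ⟨n, v, hv⟩ := Matrix.posSemidef_iff_eq_sum_vecMulVec.mp hA
  let w : Fin n → Hilb d := fun i => WithLp.toLp 2 (v i)
  have hw : 1 - Aᴴ * A = ∑ i, ketbra (w i) (w i) := hv
  -- Since `b` is a unit vector, `|b⟩⟨w i|` contributes exactly `|w i⟩⟨w i|` to the normalization,
  -- and these add up to the defect `1 - Aᴴ A`.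
  refine ⟨krausMap (Fin.cons A fun i => ketbra b (w i)), ⟨n + 1, _, ?_, rfl⟩, fun ρ => ?_⟩
  · simp only [IsKraus, Fin.sum_univ_succ, Fin.cons_zero, Fin.cons_succ, conjTranspose_ketbra,
      ketbra_mul_ketbra, inner_self_of_norm_one hb, one_smul]
    rw [← hw, add_sub_cancel]
  · rw [krausMap_apply, hw]
    simp only [Fin.sum_univ_succ, Fin.cons_zero, Fin.cons_succ, conjTranspose_ketbra,
      Finset.sum_mul, Matrix.trace_sum, trace_ketbra_mul, Finset.sum_smul]
    congr 1
    refine Finset.sum_congr rfl fun i _ => ?_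
    rw [mul_assoc, mul_ketbra, ketbra_mul_ketbra]

/-- For a unit vector `ψ` and a vector `p` orthogonal to it, `|ψ⟩⟨ψ| + κ|p⟩⟨p|` is at most the
identity as soon as `κ‖p‖² ≤ 1`. -/
lemma posSemidef_one_sub_ketbra_sub {ψ p : Hilb d} (hψ : ‖ψ‖ = 1) (hp : inner ℂ ψ p = 0) {κ : ℝ}
    (hκ0 : 0 ≤ κ) (hκ : κ * ‖p‖ ^ 2 ≤ 1) :
    (1 - (ketbra ψ ψ + (κ : ℂ) • ketbra p p)).PosSemidef := by
  rw [← Matrix.isPositive_toEuclideanLin_iff, LinearMap.isPositive_iff_complex]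
  intro v
  have hin : inner ℂ (toEuclideanLin (1 - (ketbra ψ ψ + (κ : ℂ) • ketbra p p)) v) v =
      ((‖v‖ ^ 2 - ‖inner ℂ ψ v‖ ^ 2 - κ * ‖inner ℂ p v‖ ^ 2 : ℝ) : ℂ) := by
    rw [map_sub, map_add, map_smul, LinearMap.sub_apply, LinearMap.add_apply, LinearMap.smul_apply,
      toEuclideanLin_one_apply, toEuclideanLin_ketbra, toEuclideanLin_ketbra]
    simp only [inner_sub_left, inner_add_left, inner_smul_left, Complex.conj_ofReal,
      inner_self_eq_norm_sq_to_K]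
    have h : ∀ z : ℂ, (starRingEnd ℂ) z * z = ((‖z‖ ^ 2 : ℝ) : ℂ) := fun z => by
      rw [Complex.conj_mul']; push_cast; rfl
    rw [h, h]
    push_cast
    simp only [Complex.coe_algebraMap]
    ring
  rw [hin]
  refine ⟨by rw [RCLike.re_to_complex, Complex.ofReal_re], ?_⟩
  rw [RCLike.re_to_complex, Complex.ofReal_re]
  -- Only the component `w` orthogonal to `ψ` matters: the form is `‖w‖² - κ|⟨p, w⟩|²`, nonnegative
  -- by Cauchy-Schwarz.
  set w := v - inner ℂ ψ v • ψ with hw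
  have hψw : inner ℂ ψ w = 0 := by
    rw [hw, inner_sub_right, inner_smul_right, inner_self_of_norm_one hψ, mul_one, sub_self]
  have hpψ : inner ℂ p ψ = 0 := by rw [← inner_conj_symm, hp, map_zero]
  have hv : v = inner ℂ ψ v • ψ + w := by rw [hw]; abel
  have hpv : inner ℂ p v = inner ℂ p w := by
    rw [hw, inner_sub_right, inner_smul_right, hpψ, mul_zero, sub_zero]
  have hn : ‖v‖ ^ 2 = ‖inner ℂ ψ v‖ ^ 2 + ‖w‖ ^ 2 := by
    have := norm_add_sq_eq_norm_sq_add_norm_sq_of_inner_eq_zero (𝕜 := ℂ) (inner ℂ ψ v • ψ) w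
      (by rw [inner_smul_left, hψw, mul_zero])
    rw [← hv, norm_smul, hψ] at this
    linarith
  have hcs : ‖inner ℂ p w‖ ^ 2 ≤ ‖p‖ ^ 2 * ‖w‖ ^ 2 := by
    rw [← mul_pow]
    exact pow_le_pow_left₀ (norm_nonneg _) (norm_inner_le_norm p w) 2
  rw [hpv, hn]
  nlinarith [mul_le_mul_of_nonneg_left hcs hκ0, mul_le_mul_of_nonneg_right hκ (sq_nonneg ‖w‖)]

lemma mul_eq_mul_of_supp_le {ρ : Op d} (hρ : ρ.PosSemidef) {S : Submodule ℂ (Hilb d)}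
    (h : supp ρ ≤ S) {B C : Op d} (hBC : ∀ v ∈ S, toEuclideanLin B v = toEuclideanLin C v) :
    B * ρ = C * ρ := by
  refine op_ext fun u => ?_
  rw [toEuclideanLin_mul_apply, toEuclideanLin_mul_apply]
  refine hBC _ (h ((mem_supp_iff hρ _).mpr fun w hw => ?_))
  rw [inner_toEuclideanLin_right, hρ.1.eq, hw, inner_zero_left]

/-- If the overlap of a unit vector `ψ` with a subspace is at most the one of `φ` with `b`, then some
operation maps all the states of the subspace to `b` and `ψ` to `φ`. -/
theorem exists_quantumOperation_of_norm_starProjection_le {S : Submodule ℂ (Hilb d)}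
    {ψ b φ : Hilb d} (hψ : ‖ψ‖ = 1) (hb : ‖b‖ = 1) (hφ : ‖φ‖ = 1)
    (hle : ‖S.starProjection ψ‖ ≤ ‖inner ℂ φ b‖) :
    ∃ T : Op d →ₗ[ℂ] Op d, IsQuantumOperation T ∧
      (∀ ρ, IsState ρ → supp ρ ≤ S → T ρ = ketbra b b) ∧ T (ketbra ψ ψ) = ketbra φ φ := by
  set x := S.starProjection ψ with hx
  set c := ‖x‖ with hc
  set γ := inner ℂ φ b with hγ
  set p := x - ((c ^ 2 : ℝ) : ℂ) • ψ with hp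
  set q := b - γ • φ with hq
  -- On `S` one has `⟨ψ, v⟩ = ⟨x, v⟩` and `⟨p, v⟩ = (1 - c²)⟨x, v⟩`. For nonzero `γ` and `1 - c²`,
  -- this `k` makes `|φ⟩⟨ψ| + k|q⟩⟨p|` send `v` to `⟨x, v⟩(φ + γ⁻¹ q) = ⟨x, v⟩ γ⁻¹ b`. Otherwise `k
  -- = 0` by the convention for inverses.
  set k : ℂ := (((1 - c ^ 2 : ℝ) : ℂ) * γ)⁻¹ with hk
  have hψψ := inner_self_of_norm_one hψ
  have hφφ := inner_self_of_norm_one hφ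
  have hc0 : 0 ≤ c := norm_nonneg _
  have hγ1 : ‖γ‖ ≤ 1 := by simpa [hφ, hb] using norm_inner_le_norm (𝕜 := ℂ) φ b
  have hxψ : inner ℂ x ψ = ((c ^ 2 : ℝ) : ℂ) := by
    rw [hx, inner_eq_inner_starProjection (S.starProjection_apply_mem ψ), ← hx,
      inner_self_eq_norm_sq_to_K, hc]
    push_cast; rfl
  have hψx : inner ℂ ψ x = ((c ^ 2 : ℝ) : ℂ) := by
    rw [← inner_conj_symm, hxψ, Complex.conj_ofReal]
  have hψp : inner ℂ ψ p = 0 := by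
    rw [hp, inner_sub_right, inner_smul_right, hψψ, hψx, mul_one, sub_self]
  have hpψ : inner ℂ p ψ = 0 := by rw [← inner_conj_symm, hψp, map_zero]
  have hφq : inner ℂ φ q = 0 := by
    rw [hq, inner_sub_right, inner_smul_right, hφφ, ← hγ, mul_one, sub_self]
  have hqφ : inner ℂ q φ = 0 := by rw [← inner_conj_symm, hφq, map_zero]
  have hnp : ‖p‖ ^ 2 = c ^ 2 * (1 - c ^ 2) := by
    have := norm_add_sq_eq_norm_sq_add_norm_sq_of_inner_eq_zero (𝕜 := ℂ)
      (((c ^ 2 : ℝ) : ℂ) • ψ) p (by rw [inner_smul_left, hψp, mul_zero])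
    have hadd : ((c ^ 2 : ℝ) : ℂ) • ψ + p = x := by rw [hp]; abel
    rw [hadd, norm_smul, hψ, Complex.norm_real, Real.norm_of_nonneg (sq_nonneg c), ← hc] at this
    linarith
  have hnq : ‖q‖ ^ 2 = 1 - ‖γ‖ ^ 2 := by
    have := norm_add_sq_eq_norm_sq_add_norm_sq_of_inner_eq_zero (𝕜 := ℂ)
      (γ • φ) q (by rw [inner_smul_left, hφq, mul_zero])
    have hadd : γ • φ + q = b := by rw [hq]; abel
    rw [hadd, norm_smul, hφ, hb] at this
    linarith
  have hnk : ‖k‖ ^ 2 = ((1 - c ^ 2) ^ 2 * ‖γ‖ ^ 2)⁻¹ := by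
    rw [hk, norm_inv, norm_mul, Complex.norm_real, inv_pow, mul_pow, Real.norm_eq_abs, sq_abs]
  -- Away from the degenerate cases the left side is `c²(1 - |γ|²) / ((1 - c²)|γ|²)`, which is at
  -- most one exactly when `c ≤ |γ|`: this is where `hle` is used.
  have hκ : ‖k‖ ^ 2 * ‖q‖ ^ 2 * ‖p‖ ^ 2 ≤ 1 := by
    rw [hnk, hnq, hnp]
    have hsq : c ^ 2 ≤ ‖γ‖ ^ 2 := pow_le_pow_left₀ hc0 hle 2
    have hsq1 : ‖γ‖ ^ 2 ≤ 1 := pow_le_one₀ (norm_nonneg _) hγ1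
    rcases eq_or_lt_of_le (hsq.trans hsq1) with h1 | h1
    · simp [h1]
    rcases (sq_nonneg ‖γ‖).eq_or_lt with h0 | h0
    · rw [← h0]; simp
    have h1' : 0 < 1 - c ^ 2 := by linarith
    rw [mul_assoc, inv_mul_le_iff₀ (by positivity), mul_one]
    have : (1 - ‖γ‖ ^ 2) * c ^ 2 ≤ (1 - c ^ 2) * ‖γ‖ ^ 2 := by nlinarith
    nlinarith [mul_le_mul_of_nonneg_right this h1'.le]
  set A : Op d := ketbra φ ψ + k • ketbra q p with hA
  have hAA : Aᴴ * A = ketbra ψ ψ + ((‖k‖ ^ 2 * ‖q‖ ^ 2 : ℝ) : ℂ) • ketbra p p := by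
    rw [hA, Matrix.conjTranspose_add, Matrix.conjTranspose_smul, conjTranspose_ketbra,
      conjTranspose_ketbra, add_mul, mul_add, mul_add]
    simp only [smul_mul_assoc, mul_smul_comm, ketbra_mul_ketbra, hφφ, hφq, hqφ, zero_smul,
      smul_zero, one_smul, add_zero, zero_add, inner_self_eq_norm_sq_to_K, smul_smul]
    congr 2
    rw [← mul_assoc, RCLike.star_def, Complex.mul_conj']
    push_cast
    rfl
  have hps : (1 - Aᴴ * A).PosSemidef := by
    rw [hAA]
    exact posSemidef_one_sub_ketbra_sub hψ hψp (by positivity) hκ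
  have hAψ : toEuclideanLin A ψ = φ := by
    rw [hA, map_add, map_smul, LinearMap.add_apply, LinearMap.smul_apply, toEuclideanLin_ketbra,
      toEuclideanLin_ketbra, hψψ, hpψ, one_smul, zero_smul, smul_zero, add_zero]
  have hAS : ∃ μ : ℂ, ∀ v ∈ S, toEuclideanLin A v = toEuclideanLin (ketbra b (μ • x)) v := by
    have hv : ∀ v ∈ S, toEuclideanLin A v =
        inner ℂ x v • (φ + (k * ((1 - c ^ 2 : ℝ) : ℂ)) • q) := by
      intro v hv
      have hψv : inner ℂ ψ v = inner ℂ x v := by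
        rw [hx, Submodule.inner_starProjection_left_eq_right,
          Submodule.starProjection_eq_self_iff.mpr hv]
      rw [hA, map_add, map_smul, LinearMap.add_apply, LinearMap.smul_apply, toEuclideanLin_ketbra,
        toEuclideanLin_ketbra, hp, inner_sub_left, inner_smul_left, Complex.conj_ofReal, hψv,
        smul_add, smul_smul, smul_smul]
      congr 2
      push_cast
      ring
    suffices h : ∃ ν : ℂ, ∀ v ∈ S, toEuclideanLin A v = (inner ℂ x v * ν) • b by
      obtain ⟨ν, hν⟩ := h
      refine ⟨(starRingEnd ℂ) ν, fun v hv => ?_⟩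
      rw [hν v hv, toEuclideanLin_ketbra, inner_smul_left, Complex.conj_conj, mul_comm]
    by_cases hγ0 : γ = 0
    · have hx0 : x = 0 := by
        rw [← norm_le_zero_iff]
        rwa [hγ0, norm_zero] at hle
      exact ⟨0, fun v hvS => by rw [hv v hvS, hx0]; simp⟩
    by_cases hc1 : 1 - c ^ 2 = 0
    · have hγn : ‖γ‖ = 1 := le_antisymm hγ1 ((by nlinarith : 1 ≤ c).trans hle)
      have hq0 : q = 0 := by
        rw [← norm_eq_zero, ← sq_eq_zero_iff, hnq, hγn]; norm_num
      have hbφ : b = γ • φ := sub_eq_zero.mp hq0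
      exact ⟨γ⁻¹, fun v hvS => by
        rw [hv v hvS, hq0, hbφ, smul_zero, add_zero, smul_smul, mul_assoc, inv_mul_cancel₀ hγ0,
          mul_one]⟩
    · refine ⟨γ⁻¹, fun v hvS => ?_⟩
      have hc1' : ((1 - c ^ 2 : ℝ) : ℂ) ≠ 0 := by exact_mod_cast hc1
      have hkc : k * ((1 - c ^ 2 : ℝ) : ℂ) = γ⁻¹ := by
        rw [hk, mul_inv, mul_right_comm, inv_mul_cancel₀ hc1', one_mul]
      rw [hv v hvS, hkc, hq, smul_sub, smul_smul, inv_mul_cancel₀ hγ0, one_smul, add_sub_cancel,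
        smul_smul]
  obtain ⟨T, hT, hTρ⟩ := exists_quantumOperation_of_contraction hps hb
  refine ⟨T, hT, fun ρ hρ hS => ?_, ?_⟩
  · obtain ⟨μ, hμ⟩ := hAS
    have h1 : A * ρ = ketbra b (μ • x) * ρ := mul_eq_mul_of_supp_le hρ.1 hS hμ
    have h2 : ∃ z : ℂ, A * ρ * Aᴴ = z • ketbra b b := by
      have h3 : ρ * Aᴴ = ρ * ketbra (μ • x) b := by
        have := congrArg Matrix.conjTranspose h1
        rwa [Matrix.conjTranspose_mul, Matrix.conjTranspose_mul, hρ.1.1.eq,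
          conjTranspose_ketbra] at this
      refine ⟨inner ℂ (μ • x) (toEuclideanLin ρ (μ • x)), ?_⟩
      rw [mul_assoc, h3, ← mul_assoc, h1, mul_assoc, mul_ketbra, ketbra_mul_ketbra]
    obtain ⟨z, hz⟩ := h2
    -- Both terms of `T ρ` are multiples of `|b⟩⟨b|`; trace preservation fixes the total
    -- coefficient.
    have htr : (T ρ).trace = 1 := by
      obtain ⟨n, K, hK, rfl⟩ := hT
      rw [trace_krausMap hK, hρ.2]
    rw [hTρ, hz, ← add_smul] at htr ⊢
    rw [Matrix.trace_smul, trace_ketbra, inner_self_of_norm_one hb, smul_eq_mul, mul_one] at htr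
    rw [htr, one_smul]
  · rw [hTρ, mul_ketbra, ketbra_mul, Matrix.conjTranspose_conjTranspose, hAψ, Matrix.trace_mul_comm,
      trace_ketbra_mul, map_sub, LinearMap.sub_apply, hAA, map_add, map_smul, LinearMap.add_apply,
      LinearMap.smul_apply, toEuclideanLin_ketbra, toEuclideanLin_ketbra, hpψ, hψψ,
      toEuclideanLin_one_apply]
    simp

/-! ### The sequential scheme -/

lemma seqState_congr (X : Op d →ₗ[ℂ] Op d) (ρ : Op d) {T T' : ℕ → Op d →ₗ[ℂ] Op d} (n : ℕ)
    (h : ∀ k < n, T k = T' k) : seqState X ρ T n = seqState X ρ T' n := by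
  induction n with
  | zero => rfl
  | succ n ih =>
    rw [seqState, seqState, h n n.lt_succ_self, ih fun k hk => h k (hk.trans n.lt_succ_self)]

/-- Some scheme with `n` queries, followed by a known operation, yields the states `ρ₀` and `ρ₁`
when the queries are to `X₀` and to `X₁`. -/
def IsPreparable (X₀ X₁ : Op d →ₗ[ℂ] Op d) (n : ℕ) (ρ₀ ρ₁ : Op d) : Prop :=
  ∃ (ρ : Op d) (T : ℕ → Op d →ₗ[ℂ] Op d), IsState ρ ∧ (∀ k, IsQuantumOperation (T k)) ∧
    T n (seqState X₀ ρ T n) = ρ₀ ∧ T n (seqState X₁ ρ T n) = ρ₁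

lemma isPreparable_zero (X₀ X₁ : Op d →ₗ[ℂ] Op d) {ρ : Op d} (hρ : IsState ρ) :
    IsPreparable X₀ X₁ 0 ρ ρ :=
  ⟨ρ, fun _ => LinearMap.id, hρ, fun _ => isQuantumOperation_id, rfl, rfl⟩

lemma IsPreparable.query {X₀ X₁ : Op d →ₗ[ℂ] Op d} {n : ℕ} {ρ₀ ρ₁ : Op d}
    (h : IsPreparable X₀ X₁ n ρ₀ ρ₁) {T : Op d →ₗ[ℂ] Op d} (hT : IsQuantumOperation T) :
    IsPreparable X₀ X₁ (n + 1) (T (X₀ ρ₀)) (T (X₁ ρ₁)) := by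
  obtain ⟨ρ, T', hρ, hT', rfl, rfl⟩ := h
  have hcongr : ∀ X : Op d →ₗ[ℂ] Op d,
      seqState X ρ (Function.update T' (n + 1) T) (n + 1) = seqState X ρ T' (n + 1) := fun X =>
    -- The first `n + 1` queries use only the operations with index at most `n`, so index `n + 1` is
    -- free for `T`.
    seqState_congr X ρ (n + 1) fun k hk => Function.update_of_ne hk.ne _ _
  refine ⟨ρ, Function.update T' (n + 1) T, hρ, fun k => ?_, ?_, ?_⟩
  · rcases eq_or_ne k (n + 1) with rfl | hk
    · rwa [Function.update_self]
    · rw [Function.update_of_ne hk]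
      exact hT' k
  · rw [Function.update_self, hcongr, seqState]
  · rw [Function.update_self, hcongr, seqState]

lemma IsPreparable.seqDistinguishableIn {X₀ X₁ : Op d →ₗ[ℂ] Op d} {n : ℕ} {ρ₀ ρ₁ : Op d}
    (h : IsPreparable X₀ X₁ n ρ₀ ρ₁) (hdist : PerfectlyDistinguishable (X₀ ρ₀) (X₁ ρ₁)) :
    SeqDistinguishableIn X₀ X₁ (n + 1) := by
  obtain ⟨ρ, T, hρ, hT, rfl, rfl⟩ := h
  exact ⟨ρ, T, hρ, hT, hdist⟩

lemma perfectlyDistinguishable_of_supp_le {ρ : Op d} (hρ : IsState ρ) {S : Submodule ℂ (Hilb d)}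
    (hS : supp ρ ≤ S) {ψ : Hilb d} (hψ : ψ ∈ Sᗮ) :
    PerfectlyDistinguishable ρ (ketbra ψ ψ) := by
  set P : Op d := (toEuclideanLin (𝕜 := ℂ)).symm (S.starProjection : Hilb d →ₗ[ℂ] Hilb d) with hP
  have hPv : ∀ v, toEuclideanLin P v = S.starProjection v := fun v => by
    rw [hP, LinearEquiv.apply_symm_apply]; rfl
  refine ⟨P, ?_, op_ext fun v => ?_, ?_, ?_⟩
  · rw [← Matrix.isSymmetric_toEuclideanLin_iff]
    intro v w
    rw [hPv, hPv, Submodule.inner_starProjection_left_eq_right]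
  · rw [toEuclideanLin_mul_apply, hPv, hPv,
      Submodule.starProjection_eq_self_iff.mpr (S.starProjection_apply_mem v)]
  · rw [mul_eq_mul_of_supp_le hρ.1 hS (C := 1) fun v hv => ?_, one_mul, hρ.2]
    rw [hPv, toEuclideanLin_one_apply, Submodule.starProjection_eq_self_iff.mpr hv]
  · rw [Matrix.trace_mul_comm, trace_ketbra_mul, hPv,
      (Submodule.starProjection_apply_eq_zero_iff S).mpr hψ, inner_zero_right]

/-! ### Unit vectors in a real plane, and their projections to a subspace -/

section Plane

variable {S : Submodule ℂ (Hilb d)} {s t : Hilb d}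

/-- The unit vector at angle `α` to `s` in the real plane of two orthogonal unit vectors. -/
noncomputable def planeVector (s t : Hilb d) (α : ℝ) : Hilb d :=
  (Real.cos α : ℂ) • s + (Real.sin α : ℂ) • t

lemma inner_planeVector (hs : ‖s‖ = 1) (ht : ‖t‖ = 1) (hst : inner ℂ s t = 0) (α β : ℝ) :
    inner ℂ (planeVector s t α) (planeVector s t β) = (Real.cos (α - β) : ℂ) := by
  have hts : inner ℂ t s = 0 := by rw [← inner_conj_symm, hst, map_zero]
  simp only [planeVector, inner_add_left, inner_add_right, inner_smul_left, inner_smul_right, hst,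
    hts, inner_self_of_norm_one hs, inner_self_of_norm_one ht, Complex.conj_ofReal, Real.cos_sub]
  push_cast
  ring

lemma norm_planeVector (hs : ‖s‖ = 1) (ht : ‖t‖ = 1) (hst : inner ℂ s t = 0) (α : ℝ) :
    ‖planeVector s t α‖ = 1 := by
  have h := inner_planeVector hs ht hst α α
  rw [sub_self, Real.cos_zero] at h
  have h' : ‖planeVector s t α‖ ^ 2 = 1 := by
    rw [← inner_self_eq_norm_sq (𝕜 := ℂ), h]
    simp
  exact (pow_eq_one_iff_of_nonneg (norm_nonneg _) two_ne_zero).mp h'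

lemma norm_starProjection_planeVector (hs : ‖s‖ = 1) (hsS : s ∈ S) (htS : t ∈ Sᗮ) (α : ℝ) :
    ‖S.starProjection (planeVector s t α)‖ = |Real.cos α| := by
  rw [planeVector, map_add, map_smul, map_smul, Submodule.starProjection_eq_self_iff.mpr hsS,
    (Submodule.starProjection_apply_eq_zero_iff S).mpr htS, smul_zero, add_zero, norm_smul, hs,
    mul_one, Complex.norm_real, Real.norm_eq_abs]

end Plane

/-- The iteration of the upper bound: the `E` branch always returns to the minimizer, while in the
identity branch the angle `β` from it grows by up to `θ` per query. -/
lemma isPreparable_planeVector {K : Fin m → Op d} (hK : IsKraus K) {θ : ℝ} (hθ : 0 < θ)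
    {s t : Hilb d} (hs : ‖s‖ = 1) (ht : ‖t‖ = 1)
    (hsS : s ∈ krausSpan K (planeVector s t θ)) (htS : t ∈ (krausSpan K (planeVector s t θ))ᗮ)
    (n : ℕ) {β : ℝ} (hβ0 : 0 ≤ β) (hβn : β ≤ n * θ) (hβ : θ + β ≤ Real.pi / 2) :
    IsPreparable (krausMap K) LinearMap.id n
      (ketbra (planeVector s t θ) (planeVector s t θ))
      (ketbra (planeVector s t (θ + β)) (planeVector s t (θ + β))) := by
  have hst : inner ℂ s t = 0 := (Submodule.mem_orthogonal _ _).mp htS s hsS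
  have hunit := norm_planeVector hs ht hst
  induction n generalizing β with
  | zero =>
    obtain rfl : β = 0 := le_antisymm (by simpa using hβn) hβ0
    rw [add_zero]
    exact isPreparable_zero _ _ (isState_ketbra (hunit θ))
  | succ n ih =>
    push_cast at hβn
    -- The offset required one query earlier, truncated at zero. The reset needs `cos(θ + β') ≤ cos
    -- β`, that is `β ≤ θ + β'`.
    set β' := max (β - θ) 0 with hβ'
    have hle : β ≤ θ + β' := by linarith [le_max_left (β - θ) 0]
    have hβ'0 : 0 ≤ β' := le_max_right _ _
    have hmax : θ + β' ≤ Real.pi / 2 := by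
      rcases max_choice (β - θ) 0 with h | h <;> rw [← hβ'] at h <;> rw [h] <;> linarith
    have hprep := ih hβ'0 (max_le (by linarith) (by positivity)) hmax
    obtain ⟨T, hT, hTS, hTφ⟩ := exists_quantumOperation_of_norm_starProjection_le
      (S := krausSpan K (planeVector s t θ)) (hunit (θ + β')) (hunit θ) (hunit (θ + β)) (by
        rw [norm_starProjection_planeVector hs hsS htS, inner_planeVector hs ht hst,
          Complex.norm_real, Real.norm_eq_abs, add_sub_cancel_left,
          abs_of_nonneg (Real.cos_nonneg_of_mem_Icc ⟨by linarith, hmax⟩),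
          abs_of_nonneg (Real.cos_nonneg_of_mem_Icc ⟨by linarith, by linarith⟩)]
        exact Real.cos_le_cos_of_nonneg_of_le_pi hβ0 (by linarith) hle)
    have := hprep.query hT
    rwa [LinearMap.id_apply, hTφ, hTS _ (isState_krausMap hK (isState_ketbra (hunit θ)))
      (supp_krausMap_ketbra K _).le] at this

/-- A vector whose fidelity with its output is `cos θ` lies in the plane of a vector of the span of
its images under the Kraus operators and a vector orthogonal to them. -/
lemma exists_planeVector_eq {K : Fin m → Op d} (hK : IsKraus K) {b : Hilb d} (hb : ‖b‖ = 1)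
    {θ : ℝ} (hθ : 0 < θ) (hθ' : θ ≤ Real.pi / 2) (hbθ : krausFidelity K b = Real.cos θ) :
    ∃ s ∈ krausSpan K b, ∃ t ∈ (krausSpan K b)ᗮ, ‖s‖ = 1 ∧ ‖t‖ = 1 ∧ b = planeVector s t θ := by
  obtain ⟨s, hs, hs1, hproj⟩ := exists_unit_starProjection (exists_unit_mem_krausSpan hK hb) b
  have hsin : 0 < Real.sin θ := Real.sin_pos_of_pos_of_lt_pi hθ (by linarith [Real.pi_pos])
  set r := (krausSpan K b)ᗮ.starProjection b with hr
  have hnr : ‖r‖ = Real.sin θ := by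
    have h := Submodule.norm_sq_eq_add_norm_sq_starProjection b (krausSpan K b)
    rw [← hr, hb, ← krausFidelity, hbθ] at h
    rw [← Real.sqrt_sq (norm_nonneg r), ← Real.sqrt_sq hsin.le]
    congr 1
    linarith [Real.sin_sq_add_cos_sq θ]
  -- Here `θ > 0` is essential: it leaves a component orthogonal to the span, which normalizes to
  -- `t`.
  have hr0 : r ≠ 0 := norm_pos_iff.mp (hnr ▸ hsin)
  refine ⟨s, hs, ((‖r‖ : ℂ)⁻¹) • r,
    Submodule.smul_mem _ _ (Submodule.starProjection_apply_mem _ _), hs1,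
    norm_smul_inv_norm_self hr0, ?_⟩
  rw [planeVector, ← hnr, norm_smul_smul_inv_norm_self, ← hbθ, krausFidelity, ← hproj, hr,
    Submodule.starProjection_add_starProjection_orthogonal]

/-- After `n` queries the offset `π/2 - θ` is reachable, so the second vector is `t`, which is
orthogonal to the support of the output of `b`; the remaining query finishes. -/
theorem seqDistinguishableIn_succ {K : Fin m → Op d} (hK : IsKraus K) {b : Hilb d} (hb : ‖b‖ = 1)
    {θ : ℝ} (hθ : 0 < θ) (hθ' : θ ≤ Real.pi / 2) (hbθ : krausFidelity K b = Real.cos θ) {n : ℕ}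
    (hn : Real.pi / 2 ≤ (n + 1) * θ) :
    SeqDistinguishableIn (krausMap K) LinearMap.id (n + 1) := by
  obtain ⟨s, hs, t, ht, hs1, ht1, rfl⟩ := exists_planeVector_eq hK hb hθ hθ' hbθ
  have hprep := isPreparable_planeVector hK hθ hs1 ht1 hs ht n (β := Real.pi / 2 - θ)
    (by linarith) (by linarith) (by linarith)
  refine hprep.seqDistinguishableIn (perfectlyDistinguishable_of_supp_le
    (isState_krausMap hK (isState_ketbra hb)) (supp_krausMap_ketbra K _).le ?_)
  simpa [planeVector] using ht

/-! ### The maximal overlap -/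

lemma forall_span_trace_eq_zero_iff {K : Fin m → Op d} {b b' : Hilb d} :
    (∀ A ∈ Submodule.span ℂ (Set.range K), (ketbra b b' * A).trace = 0) ↔
      b' ∈ (krausSpan K b)ᗮ := by
  simp_rw [mem_krausSpan_orthogonal, trace_ketbra_mul]
  constructor
  · intro h i
    rw [← inner_conj_symm, h _ (Submodule.subset_span ⟨i, rfl⟩), map_zero]
  · intro h A hA
    induction hA using Submodule.span_induction with
    | mem A hA => obtain ⟨i, rfl⟩ := hA; rw [← inner_conj_symm, h i, map_zero]
    | zero => rw [map_zero, LinearMap.zero_apply, inner_zero_right]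
    | add x y _ _ hx hy => rw [map_add, LinearMap.add_apply, inner_add_right, hx, hy, add_zero]
    | smul c x _ hx => rw [map_smul, LinearMap.smul_apply, inner_smul_right, hx, mul_zero]

/-- If some vector has fidelity `cos θ` with its output, the maximal overlap is `sin θ`. -/
lemma isGreatest_overlapSet {K : Fin m → Op d} (hK : IsKraus K) {b : Hilb d} (hb : ‖b‖ = 1)
    {θ : ℝ} (hθ : 0 < θ) (hθ' : θ ≤ Real.pi / 2) (hbθ : krausFidelity K b = Real.cos θ) :
    IsGreatest (overlapSet K (Real.cos θ)) (Real.sin θ) := by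
  constructor
  · obtain ⟨s, hs, t, ht, hs1, ht1, rfl⟩ := exists_planeVector_eq hK hb hθ hθ' hbθ
    refine ⟨_, t, hb, ht1, by rw [maxFidelity_krausMap_ketbra hK hb, hbθ],
      forall_span_trace_eq_zero_iff.mpr ht, ?_⟩
    have hst : inner ℂ s t = 0 := (Submodule.mem_orthogonal _ _).mp ht s hs
    have := inner_planeVector hs1 ht1 hst θ (Real.pi / 2)
    rw [Real.cos_sub_pi_div_two] at this
    have ht' : planeVector s t (Real.pi / 2) = t := by simp [planeVector]
    rw [ht'] at this
    rw [this, Complex.norm_real, Real.norm_of_nonneg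
      (Real.sin_nonneg_of_nonneg_of_le_pi hθ.le (by linarith [Real.pi_pos]))]
  · rintro _ ⟨c, c', hc, hc', hfid, hort, rfl⟩
    rw [maxFidelity_krausMap_ketbra hK hc] at hfid
    obtain ⟨s, hs, t, -, -, ht1, rfl⟩ := exists_planeVector_eq hK hc hθ hθ' hfid
    have hsc := (Submodule.mem_orthogonal _ _).mp (forall_span_trace_eq_zero_iff.mp hort) s hs
    -- Since `c'` is orthogonal to `s`, only the component `sin θ t` contributes to the overlap.
    nth_rewrite 1 [planeVector]
    rw [inner_add_left, inner_smul_left, inner_smul_left, hsc, mul_zero, zero_add,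
      Complex.conj_ofReal, norm_mul, Complex.norm_real, Real.norm_of_nonneg
      (Real.sin_nonneg_of_nonneg_of_le_pi hθ.le (by linarith [Real.pi_pos]))]
    have := norm_inner_le_norm (𝕜 := ℂ) t c'
    rw [ht1, hc', one_mul] at this
    exact mul_le_of_le_one_right
      (Real.sin_nonneg_of_nonneg_of_le_pi hθ.le (by linarith [Real.pi_pos])) this

/-! ### The number of queries -/

/-- The addition formula with its nonnegative product of sines dropped. -/
lemma cos_nat_mul_le_cos_pow {θ : ℝ} (hθ : 0 ≤ θ) (k : ℕ) (hk : k * θ ≤ Real.pi / 2) :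
    Real.cos (k * θ) ≤ Real.cos θ ^ k := by
  induction k with
  | zero => simp
  | succ k ih =>
    push_cast at hk ⊢
    have hk0 : 0 ≤ k * θ := by positivity
    have hc : 0 ≤ Real.cos θ := Real.cos_nonneg_of_mem_Icc ⟨by linarith, by linarith⟩
    rw [add_mul, one_mul, Real.cos_add, pow_succ]
    have h1 := mul_le_mul_of_nonneg_right (ih (by linarith)) hc
    have h2 := mul_nonneg
      (Real.sin_nonneg_of_nonneg_of_le_pi hk0 (by linarith [Real.pi_pos]))
      (Real.sin_nonneg_of_nonneg_of_le_pi hθ (by linarith [Real.pi_pos]))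
    linarith

lemma exists_nat_eq_ceil_ln_div_ln {θ : ℝ} (hθ : 0 < θ) (hθ' : θ ≤ Real.pi / 2) :
    ∃ k : ℕ, (k : ℤ) = ⌈ln (Real.sin θ) / ln (Real.cos θ)⌉ ∧ Real.pi / 2 ≤ (k + 1) * θ := by
  rcases hθ'.eq_or_lt with rfl | hlt
  -- At `θ = π/2` the convention `ln 0 = 1` makes the quotient `0 / 1 = 0`, and one query suffices.
  · exact ⟨0, by simp [ln], by simp⟩
  have hcos : 0 < Real.cos θ := Real.cos_pos_of_mem_Ioo ⟨by linarith, hlt⟩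
  have hsin : 0 < Real.sin θ := Real.sin_pos_of_pos_of_lt_pi hθ (by linarith)
  have hsq := Real.sin_sq_add_cos_sq θ
  have hcos1 : Real.cos θ < 1 := by nlinarith
  have hlc : Real.log (Real.cos θ) < 0 := Real.log_neg hcos hcos1
  have hls : Real.log (Real.sin θ) ≤ 0 := Real.log_nonpos hsin.le (Real.sin_le_one θ)
  rw [ln, ln, if_neg hsin.ne', if_neg hcos.ne']
  refine ⟨⌈Real.log (Real.sin θ) / Real.log (Real.cos θ)⌉₊,
    Int.natCast_ceil_eq_ceil (div_nonneg_of_nonpos hls hlc.le), ?_⟩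
  have hk := Nat.le_ceil (Real.log (Real.sin θ) / Real.log (Real.cos θ))
  set k := ⌈Real.log (Real.sin θ) / Real.log (Real.cos θ)⌉₊
  -- As `log (cos θ) < 0`, the ceiling bound reads `cos^k θ ≤ sin θ = cos(π/2 - θ)`; comparison with
  -- `cos(kθ)` then forces `kθ ≥ π/2 - θ`.
  rw [div_le_iff_of_neg hlc, ← Real.log_pow, Real.log_le_log_iff (by positivity) hsin] at hk
  by_contra! hcon
  rw [add_mul, one_mul] at hcon
  have hk0 : 0 ≤ k * θ := by positivity
  have h1 := (cos_nat_mul_le_cos_pow hθ.le k (by linarith)).trans hk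
  rw [← Real.cos_pi_div_two_sub] at h1
  exact h1.not_gt (Real.cos_lt_cos_of_nonneg_of_le_pi hk0 (by linarith) (by linarith))

end SeqDisc

/-! ### The theorem -/

theorem theorem3 (d m : ℕ) (hd : 0 < d) (E : Fin m → SeqDisc.Op d) (hE : SeqDisc.IsKraus E) :
    IsLeast (SeqDisc.fidelitySet 1 (SeqDisc.krausMap E) LinearMap.id)
      (SeqDisc.qMaxFidelity 1 (SeqDisc.krausMap E) LinearMap.id) ∧
    (SeqDisc.SeqDistinguishable (SeqDisc.krausMap E) LinearMap.id ↔
      SeqDisc.qMaxFidelity 1 (SeqDisc.krausMap E) LinearMap.id < 1) ∧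
    (SeqDisc.qMaxFidelity 1 (SeqDisc.krausMap E) LinearMap.id < 1 →
      ∃ θ : ℝ, 0 < θ ∧ θ ≤ Real.pi / 2 ∧
        SeqDisc.qMaxFidelity 1 (SeqDisc.krausMap E) LinearMap.id = Real.cos θ ∧
      ∃ α₀ : ℝ, 0 ≤ α₀ ∧ α₀ ≤ Real.pi / 2 ∧
        IsGreatest (SeqDisc.overlapSet E (Real.cos θ)) (Real.cos α₀) ∧
      ∃ N : ℕ,
        IsLeast {n : ℕ | SeqDisc.SeqDistinguishableIn (SeqDisc.krausMap E) LinearMap.id n} N ∧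
        ⌈Real.pi / (2 * Real.arccos
          (SeqDisc.qMaxFidelity 1 (SeqDisc.krausMap E) LinearMap.id))⌉ ≤ (N : ℤ) ∧
        (N : ℤ) ≤ ⌈SeqDisc.ln (Real.cos α₀) / SeqDisc.ln (Real.cos θ)⌉ + 1) := by
  obtain ⟨b, hb, hmin⟩ := SeqDisc.exists_min_krausFidelity hd E
  have hleast := SeqDisc.isLeast_fidelitySet hE hb hmin
  have hF : SeqDisc.qMaxFidelity 1 (SeqDisc.krausMap E) LinearMap.id =
      SeqDisc.krausFidelity E b := hleast.csInf_eq
  have hF0 := SeqDisc.krausFidelity_nonneg E b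
  have hF1 : SeqDisc.krausFidelity E b ≤ 1 := by
    rw [← hb]
    exact Submodule.norm_starProjection_apply_le _ _
  rw [hF]
  set θ := Real.arccos (SeqDisc.krausFidelity E b) with hθ
  have hcos : Real.cos θ = SeqDisc.krausFidelity E b := Real.cos_arccos (by linarith) hF1
  have hθ0 : 0 ≤ θ := Real.arccos_nonneg _
  have hθ' : θ ≤ Real.pi / 2 := Real.arccos_le_pi_div_two.mpr hF0
  have hlower : ∀ n, SeqDisc.SeqDistinguishableIn (SeqDisc.krausMap E) LinearMap.id n →
      Real.pi / 2 ≤ n * θ := fun n =>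
    SeqDisc.pi_div_two_le_of_seqDistinguishableIn hE hθ0 (by rwa [hcos])
  have hpos : SeqDisc.krausFidelity E b < 1 → 0 < θ := Real.arccos_pos.mpr
  refine ⟨hleast, ⟨fun ⟨n, hn⟩ => ?_, fun hlt => ?_⟩, fun hlt => ?_⟩
  · refine lt_of_le_of_ne hF1 fun h1 => ?_
    have := hlower n hn
    rw [hθ, h1, Real.arccos_one, mul_zero] at this
    linarith [Real.pi_pos]
  · obtain ⟨k, -, hk⟩ := SeqDisc.exists_nat_eq_ceil_ln_div_ln (hpos hlt) hθ'
    exact ⟨k + 1, SeqDisc.seqDistinguishableIn_succ hE hb (hpos hlt) hθ' hcos.symm hk⟩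
  · have hθp := hpos hlt
    obtain ⟨k, hk, hkθ⟩ := SeqDisc.exists_nat_eq_ceil_ln_div_ln hθp hθ'
    have hmem := SeqDisc.seqDistinguishableIn_succ hE hb hθp hθ' hcos.symm hkθ
    have hex : ∃ n, SeqDisc.SeqDistinguishableIn (SeqDisc.krausMap E) LinearMap.id n := ⟨_, hmem⟩
    classical
    refine ⟨θ, hθp, hθ', hcos.symm, Real.pi / 2 - θ, by linarith, by linarith, ?_,
      Nat.find hex, ⟨Nat.find_spec hex, fun n hn => Nat.find_min' hex hn⟩, ?_, ?_⟩
    · rw [Real.cos_pi_div_two_sub]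
      exact SeqDisc.isGreatest_overlapSet hE hb hθp hθ' hcos.symm
    · rw [Int.ceil_le, div_le_iff₀ (by positivity)]
      have := hlower _ (Nat.find_spec hex)
      push_cast
      linarith
    · rw [Real.cos_pi_div_two_sub, ← hk]
      exact_mod_cast Nat.find_min' hex hmem
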